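/- For a positive integer $m$ let $\gamma(m)=\prod_{p\mid m}p$ be the product of the distinct primes dividing $m$ (so $\gamma(1)=1$), and let $\phi(m)$ be Euler's totient function, the number of positive integers up to $m$ that are relatively prime to $m$. Throughout, $p$ denotes a prime, and $\gamma_0=\lim_{n\to\infty}\big(\sum_{k=1}^n \frac1k-\log n\big)$ denotes the Euler--Mascheroni constant. Then for every integer $n\ge 0$, $$\gamma(n!)=\prod_{p\le n}p\qquad\text{and}\qquad \phi(n!)=n!\prod_{p\le n}\Big(1-\frac1p\Big).$$ In particular, as $n\to\infty$, $$\gamma(n!)=e^{(1+o(1))n}\qquad\text{and}\qquad \phi(n!)\sim n!\,\frac{e^{-\gamma_0}}{\log n}.$$ -/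

import Mathlib

/-- The kernel function `γ(n) = ∏_{p ∣ n} p`, the product of the distinct primes dividing `n`
(an empty product for `n = 1`, so `γ(1) = 1`). -/
def kernelFn (n : ℕ) : ℕ := ∏ p ∈ n.primeFactors, p

/-! A prime divides $n!$ exactly when it is at most $n$, which gives both product formulas. Hence
$\log\gamma(n!)=\theta(n)$, and the asymptotics are the prime number theorem and Mertens' third
theorem.

Prime number theorem: $f(t)=\psi(e^t)e^{-t}$ is bounded by Chebyshev, and the Laplace transform of
$f-1$ extends continuously to $\Re s\ge 0$ (`laplace_psi`). Averaging $f-1$ against a translated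
Fejér kernel gives a Fourier integral over $[-1,1]$, which tends to $0$ by Riemann–Lebesgue
(`tendsto_integral_mul_fejer`). As the kernel is nonnegative and can be concentrated, neither $f-1$
nor $1-f$ stays above a positive constant on far intervals of fixed length; monotonicity of
$f(t)e^t$ turns this into $f\to1$ (`tendsto_one_of_laplace`). Finally $\psi-\theta=O(\sqrt x)$.

Mertens: $\log n!=\sum_{k\le n}\Lambda(k)\lfloor n/k\rfloor$ gives $\sum_{p\le t}\log p/p=\log
t+O(1)$, and partial summation gives $-\sum_{p\le t}\log(1-1/p)=\log\log t+C+o(1)$. To find $C$, let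
$D(\delta)=-\sum_p p^{-\delta}\log(1-1/p)$ with $\delta\to0^+$. As a Laplace transform,
$D(\delta)=-\log\delta+C+\Gamma'(1)+o(1)$ with $\Gamma'(1)=-\gamma_0$; by the Euler product,
$D(\delta)=\log\zeta(1+\delta)+o(1)=-\log\delta+o(1)$. So $C=\gamma_0$. -/

open Filter Topology MeasureTheory

/-! ### The Fejér kernel -/

/-- The Fejér kernel, as the Fourier transform of the triangle function. -/
noncomputable def fejer (u : ℝ) : ℝ := ∫ y in (0 : ℝ)..1, 2 * (1 - y) * Real.cos (u * y)

theorem continuous_fejer : Continuous fejer := by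
  unfold fejer
  exact intervalIntegral.continuous_parametric_intervalIntegral_of_continuous' (by fun_prop) 0 1

theorem fejer_zero : fejer 0 = 1 := by
  simp only [fejer, zero_mul, Real.cos_zero, mul_one]
  have h : ∀ y ∈ Set.uIcc (0 : ℝ) 1, HasDerivAt (fun y : ℝ => 2 * y - y ^ 2) (2 * (1 - y)) y := by
    intro y _
    convert! ((hasDerivAt_id' y).const_mul 2).sub (hasDerivAt_pow 2 y) using 1
    norm_num
    ring
  rw [intervalIntegral.integral_eq_sub_of_hasDerivAt h
    (Continuous.intervalIntegrable (by fun_prop) _ _)]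
  norm_num

/-- Integration by parts supplies the antiderivative. Positivity and quadratic decay are read off
from this form. -/
theorem fejer_eq {u : ℝ} (hu : u ≠ 0) : fejer u = 2 * (1 - Real.cos u) / u ^ 2 := by
  have h : ∀ y ∈ Set.uIcc (0 : ℝ) 1, HasDerivAt
      (fun y : ℝ => 2 * (1 - y) * (Real.sin (u * y) / u) - 2 * Real.cos (u * y) / u ^ 2)
      (2 * (1 - y) * Real.cos (u * y)) y := by
    intro y _
    have h1 : HasDerivAt (fun y : ℝ => u * y) u y := by
      simpa using (hasDerivAt_id' y).const_mul u
    have h2 : HasDerivAt (fun y : ℝ => 2 * (1 - y)) (-2) y := by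
      simpa using ((hasDerivAt_id' y).const_sub 1).const_mul 2
    convert! (h2.mul (h1.sin.div_const u)).sub ((h1.cos.const_mul 2).div_const (u ^ 2)) using 1
    field_simp
    ring
  rw [fejer, intervalIntegral.integral_eq_sub_of_hasDerivAt h
    (Continuous.intervalIntegrable (by fun_prop) _ _)]
  simp
  ring

theorem fejer_nonneg (u : ℝ) : 0 ≤ fejer u := by
  rcases eq_or_ne u 0 with rfl | hu
  · simp [fejer_zero]
  · rw [fejer_eq hu]
    have := Real.cos_le_one u
    have : 0 ≤ 1 - Real.cos u := by linarith
    positivity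

theorem fejer_le (u : ℝ) : fejer u ≤ 5 * (1 + u ^ 2)⁻¹ := by
  rw [← div_eq_mul_inv, le_div_iff₀ (by positivity)]
  rcases eq_or_ne u 0 with rfl | hu
  · simp [fejer_zero]
  · rw [fejer_eq hu, div_mul_eq_mul_div, div_le_iff₀ (by positivity)]
    have h1 := Real.neg_one_le_cos u
    have h2 := Real.one_sub_sq_div_two_le_cos (x := u)
    -- The constant is $5=1+4$, from $2(1-\cos u)\le u^2$ and $2(1-\cos u)u^2\le 4u^2$.
    nlinarith [mul_nonneg (sq_nonneg u) (by linarith : 0 ≤ 1 + Real.cos u), sq_nonneg u]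

theorem integrable_fejer : Integrable fejer :=
  (integrable_inv_one_add_sq.const_mul 5).mono' continuous_fejer.aestronglyMeasurable
    (.of_forall fun u => by
      rw [Real.norm_of_nonneg (fejer_nonneg u)]; exact fejer_le u)

theorem integral_fejer_pos : 0 < ∫ u, fejer u :=
  integral_pos_of_integrable_nonneg_nonzero continuous_fejer integrable_fejer fejer_nonneg
    (x := 0) (by simp [fejer_zero])

/-- Folding $y\mapsto -y$ pairs the exponentials into a cosine. The frequencies fill only $[-1,1]$,
so a compact piece of the line $\Re s=0$ suffices later. -/
theorem integral_triangle_mul_exp (u : ℝ) :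
    ∫ y in (-1 : ℝ)..1, ((1 - |y| : ℝ) : ℂ) * Complex.exp (-(u * y * Complex.I)) = fejer u := by
  have hi : ∀ a b : ℝ, IntervalIntegrable
      (fun y : ℝ => ((1 - |y| : ℝ) : ℂ) * Complex.exp (-(u * y * Complex.I))) volume a b :=
    fun a b => Continuous.intervalIntegrable (by fun_prop) _ _
  rw [← intervalIntegral.integral_add_adjacent_intervals (hi (-1) 0) (hi 0 1)]
  have h := intervalIntegral.integral_comp_neg (a := 0) (b := 1)
    (fun y : ℝ => ((1 - |y| : ℝ) : ℂ) * Complex.exp (-(u * y * Complex.I)))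
  rw [neg_zero] at h
  rw [← h, ← intervalIntegral.integral_add (Continuous.intervalIntegrable (by fun_prop) _ _)
    (hi 0 1), fejer, ← intervalIntegral.integral_ofReal]
  refine intervalIntegral.integral_congr fun y hy => ?_
  rw [Set.uIcc_of_le zero_le_one] at hy
  simp only [abs_neg, abs_of_nonneg hy.1]
  push_cast
  rw [Complex.cos]
  ring_nf

/-! ### Tauberian theorem of Wiener–Ikehara type -/

section Tauberian

/-- Write the kernel as its Fourier integral and apply Fubini; the factor $e^{-\delta t}$ makes the
double integral absolutely convergent. -/
theorem integral_mul_exp_mul_fejer {r : ℝ → ℝ} {M : ℝ} {G : ℂ → ℂ} (hr : Measurable r)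
    (hM : ∀ t, |r t| ≤ M)
    (hG : ∀ s : ℂ, 0 < s.re → ∫ t in Set.Ioi (0 : ℝ), (r t : ℂ) * Complex.exp (-(s * t)) = G s)
    {δ : ℝ} (hδ : 0 < δ) (x : ℝ) :
    ∫ t in Set.Ioi (0 : ℝ), ((r t * Real.exp (-(δ * t)) * fejer (t - x) : ℝ) : ℂ) =
      ∫ y in (-1 : ℝ)..1, ((1 - |y| : ℝ) : ℂ) * Complex.exp (x * y * Complex.I) *
        G (δ + y * Complex.I) := by
  let F : ℝ → ℝ → ℂ := fun y t => ((1 - |y| : ℝ) : ℂ) * Complex.exp (x * y * Complex.I) *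
    ((r t : ℂ) * Complex.exp (-((δ + y * Complex.I) * t)))
  have hF : Integrable (Function.uncurry F)
      ((volume.restrict (Set.Ioc (-1 : ℝ) 1)).prod (volume.restrict (Set.Ioi (0 : ℝ)))) := by
    have h1 : Integrable (fun _ : ℝ => (1 : ℝ)) (volume.restrict (Set.Ioc (-1 : ℝ) 1)) :=
      integrable_const _
    have h2 : Integrable (fun t : ℝ => M * Real.exp (-δ * t)) (volume.restrict (Set.Ioi (0 : ℝ))) :=
      (exp_neg_integrableOn_Ioi 0 hδ).const_mul M
    refine (h1.mul_prod h2).mono' (Measurable.aestronglyMeasurable ?_) ?_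
    · simp only [Function.uncurry_def, F]
      fun_prop
    · rw [Measure.prod_restrict]
      filter_upwards [ae_restrict_mem (measurableSet_Ioc.prod measurableSet_Ioi)] with p hp
      simp only [Function.uncurry_def, F, norm_mul, Complex.norm_exp, Complex.norm_real,
        Real.norm_eq_abs]
      have h3 : |1 - (|p.1|)| ≤ 1 := by
        have := abs_le.2 ⟨hp.1.1.le, hp.1.2⟩
        rw [abs_of_nonneg (by linarith)]
        linarith [abs_nonneg p.1]
      have h4 : 0 ≤ M := (abs_nonneg _).trans (hM 0)
      have h5 : |1 - (|p.1|)| * |r p.2| ≤ M := by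
        simpa using mul_le_mul h3 (hM p.2) (abs_nonneg _) zero_le_one
      have h6 := mul_le_mul_of_nonneg_right h5 (Real.exp_pos (-δ * p.2)).le
      simpa [mul_assoc] using h6
  have h1 : ∀ y : ℝ, ((1 - |y| : ℝ) : ℂ) * Complex.exp (x * y * Complex.I) *
        G (δ + y * Complex.I) = ∫ t in Set.Ioi (0 : ℝ), F y t := by
    intro y
    rw [← hG _ (by simpa using hδ), ← integral_const_mul]
  simp_rw [h1]
  rw [intervalIntegral.integral_of_le (by norm_num), integral_integral_swap hF]
  refine integral_congr_ae (.of_forall fun t => ?_)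
  simp only [F]
  rw [Complex.ofReal_mul, ← integral_triangle_mul_exp,
    ← intervalIntegral.integral_of_le (by norm_num), ← intervalIntegral.integral_const_mul]
  refine intervalIntegral.integral_congr fun y _ => ?_
  have key : Complex.exp (x * y * Complex.I) * Complex.exp (-((δ + y * Complex.I) * t)) =
      Complex.exp (-(δ * t)) * Complex.exp (-((t - x) * y * Complex.I)) := by
    rw [← Complex.exp_add, ← Complex.exp_add]
    ring_nf
  push_cast
  linear_combination -(1 - ((|y| : ℝ) : ℂ)) * (r t : ℂ) * key

/-- Let $\delta\to0^+$ in the damped identity. The left side is dominated by $M$ times the kernel,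
the right by a bound for `G` on a compact rectangle touching the imaginary axis. -/
theorem integral_mul_fejer {r : ℝ → ℝ} {M : ℝ} {G : ℂ → ℂ} (hr : Measurable r)
    (hM : ∀ t, |r t| ≤ M)
    (hG : ∀ s : ℂ, 0 < s.re → ∫ t in Set.Ioi (0 : ℝ), (r t : ℂ) * Complex.exp (-(s * t)) = G s)
    (hc : ContinuousOn G {s | 0 ≤ s.re}) (x : ℝ) :
    ((∫ t in Set.Ioi (0 : ℝ), r t * fejer (t - x) : ℝ) : ℂ) =
      ∫ y in (-1 : ℝ)..1, ((1 - |y| : ℝ) : ℂ) * Complex.exp (x * y * Complex.I) *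
        G (y * Complex.I) := by
  have hM0 : 0 ≤ M := (abs_nonneg _).trans (hM 0)
  have hK : Integrable (fun t => M * fejer (t - x)) :=
    (integrable_fejer.comp_sub_right x).const_mul M
  have hm : Measurable fejer := continuous_fejer.measurable
  have h1 : Tendsto (fun δ : ℝ =>
      ∫ t in Set.Ioi (0 : ℝ), ((r t * Real.exp (-(δ * t)) * fejer (t - x) : ℝ) : ℂ)) (𝓝[>] 0)
      (𝓝 (∫ t in Set.Ioi (0 : ℝ), ((r t * fejer (t - x) : ℝ) : ℂ))) := by
    refine tendsto_integral_filter_of_dominated_convergence (fun t => M * fejer (t - x)) ?_ ?_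
      hK.integrableOn ?_
    · refine .of_forall fun δ => Measurable.aestronglyMeasurable ?_
      fun_prop
    · filter_upwards [self_mem_nhdsWithin] with δ hδ
      filter_upwards [ae_restrict_mem measurableSet_Ioi] with t ht
      rw [Complex.norm_real, norm_mul, norm_mul, Real.norm_of_nonneg (fejer_nonneg _),
        Real.norm_of_nonneg (Real.exp_pos _).le, Real.norm_eq_abs]
      refine mul_le_mul_of_nonneg_right ?_ (fejer_nonneg _)
      have : Real.exp (-(δ * t)) ≤ 1 := by
        rw [Real.exp_le_one_iff]
        have := mul_pos (Set.mem_Ioi.1 hδ) (Set.mem_Ioi.1 ht)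
        linarith
      simpa using mul_le_mul (hM t) this (Real.exp_pos _).le hM0
    · refine .of_forall fun t => ?_
      have : Continuous fun δ : ℝ => ((r t * Real.exp (-(δ * t)) * fejer (t - x) : ℝ) : ℂ) := by
        fun_prop
      simpa using (this.tendsto 0).mono_left nhdsWithin_le_nhds
  have h2 : Tendsto (fun δ : ℝ => ∫ y in (-1 : ℝ)..1, ((1 - |y| : ℝ) : ℂ) *
      Complex.exp (x * y * Complex.I) * G (δ + y * Complex.I)) (𝓝[>] 0)
      (𝓝 (∫ y in (-1 : ℝ)..1, ((1 - |y| : ℝ) : ℂ) *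
        Complex.exp (x * y * Complex.I) * G (y * Complex.I))) := by
    have hcomp : ContinuousOn (fun p : ℝ × ℝ => G (p.1 + p.2 * Complex.I))
        (Set.Icc (0 : ℝ) 1 ×ˢ Set.Icc (-1 : ℝ) 1) :=
      hc.comp (by fun_prop) fun p hp => by simpa using hp.1.1
    obtain ⟨B, hB⟩ := (isCompact_Icc.prod isCompact_Icc).exists_bound_of_continuousOn hcomp
    have hu : Set.uIoc (-1 : ℝ) 1 = Set.Ioc (-1) 1 := Set.uIoc_of_le (by norm_num)
    have hev : ∀ᶠ δ : ℝ in 𝓝[>] 0, δ ∈ Set.Ioc (0 : ℝ) 1 := Ioc_mem_nhdsGT zero_lt_one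
    refine intervalIntegral.tendsto_integral_filter_of_dominated_convergence (fun _ => 1 * 1 * B)
      ?_ ?_ intervalIntegrable_const ?_
    · filter_upwards [hev] with δ hδ
      refine ContinuousOn.aestronglyMeasurable ?_ measurableSet_uIoc
      rw [hu]
      refine ContinuousOn.mul (by fun_prop) ?_
      exact hcomp.comp (f := fun y : ℝ => (δ, y)) (by fun_prop)
        fun y hy => ⟨⟨hδ.1.le, hδ.2⟩, ⟨hy.1.le, hy.2⟩⟩
    · filter_upwards [hev] with δ hδ
      refine .of_forall fun y hy => ?_
      rw [hu] at hy
      rw [norm_mul, norm_mul]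
      have hy' := abs_le.2 ⟨hy.1.le, hy.2⟩
      have hb := hB (δ, y) ⟨⟨hδ.1.le, hδ.2⟩, ⟨hy.1.le, hy.2⟩⟩
      gcongr
      · rw [Complex.norm_real, Real.norm_of_nonneg (by linarith)]
        linarith [abs_nonneg y]
      · rw [show (x * y * Complex.I : ℂ) = ((x * y : ℝ) : ℂ) * Complex.I by push_cast; ring,
          Complex.norm_exp_ofReal_mul_I]
    · refine .of_forall fun y hy => Tendsto.const_mul _ ?_
      rw [hu] at hy
      have h3 := (hcomp (0, y) ⟨⟨le_rfl, zero_le_one⟩, ⟨hy.1.le, hy.2⟩⟩).tendsto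
      have h4 : Tendsto (fun δ : ℝ => (δ, y)) (𝓝[>] 0)
          (𝓝[Set.Icc (0 : ℝ) 1 ×ˢ Set.Icc (-1 : ℝ) 1] (0, y)) := by
        refine tendsto_nhdsWithin_iff.2 ⟨?_, ?_⟩
        · exact ((continuous_id.prodMk continuous_const).tendsto (0 : ℝ)).mono_left
            nhdsWithin_le_nhds
        · filter_upwards [hev] with δ hδ using ⟨⟨hδ.1.le, hδ.2⟩, ⟨hy.1.le, hy.2⟩⟩
      simpa [Function.comp_def] using h3.comp h4
  rw [← integral_complex_ofReal]
  refine tendsto_nhds_unique h1 (h2.congr' ?_)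
  filter_upwards [self_mem_nhdsWithin] with δ hδ
  exact (integral_mul_exp_mul_fejer hr hM hG hδ x).symm

theorem tendsto_integral_mul_fejer {r : ℝ → ℝ} {M : ℝ} {G : ℂ → ℂ} (hr : Measurable r)
    (hM : ∀ t, |r t| ≤ M)
    (hG : ∀ s : ℂ, 0 < s.re → ∫ t in Set.Ioi (0 : ℝ), (r t : ℂ) * Complex.exp (-(s * t)) = G s)
    (hc : ContinuousOn G {s | 0 ≤ s.re}) :
    Tendsto (fun x => ∫ t in Set.Ioi (0 : ℝ), r t * fejer (t - x)) atTop (𝓝 0) := by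
  let f : ℝ → ℂ := (Set.Ioc (-1 : ℝ) 1).indicator
    fun y => ((1 - |y| : ℝ) : ℂ) * G (y * Complex.I)
  have h1 := Real.tendsto_integral_exp_smul_cocompact f
  -- The Fourier character is $e^{-2\pi i yw}$, so $w=-x/(2\pi)$ produces $e^{ixy}$.
  have h2 : Tendsto (fun x : ℝ => -x / (2 * Real.pi)) atTop (cocompact ℝ) := by
    refine Tendsto.mono_right ?_ atBot_le_cocompact
    exact (tendsto_neg_atTop_atBot).atBot_div_const (by positivity)
  have h3 := h1.comp h2
  have h4 : Tendsto (fun x => ((∫ t in Set.Ioi (0 : ℝ), r t * fejer (t - x) : ℝ) : ℂ))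
      atTop (𝓝 ((0 : ℝ) : ℂ)) := by
    refine h3.congr fun x => ?_
    rw [integral_mul_fejer hr hM hG hc, intervalIntegral.integral_of_le (by norm_num),
      ← integral_indicator measurableSet_Ioc]
    refine integral_congr_ae (.of_forall fun y => ?_)
    by_cases hy : y ∈ Set.Ioc (-1 : ℝ) 1
    · simp only [f, Set.indicator_of_mem hy, Circle.smul_def, Real.fourierChar_apply, smul_eq_mul]
      rw [← mul_assoc, mul_comm (Complex.exp _)]
      congr 3
      push_cast
      have : (Real.pi : ℂ) ≠ 0 := by exact_mod_cast Real.pi_ne_zero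
      field_simp
    · simp [f, Set.indicator_of_notMem hy]
  exact Complex.continuous_re.continuousAt.tendsto.comp h4

end Tauberian

/-- If $r\ge\varepsilon$ on the whole window, a kernel with most of its mass there gives an average
bounded below by a positive constant, although the averages tend to $0$. -/
theorem eventually_exists_lt_of_laplace {r : ℝ → ℝ} {M : ℝ} {G : ℂ → ℂ} (hr : Measurable r)
    (hM : ∀ t, |r t| ≤ M)
    (hG : ∀ s : ℂ, 0 < s.re → ∫ t in Set.Ioi (0 : ℝ), (r t : ℂ) * Complex.exp (-(s * t)) = G s)
    (hc : ContinuousOn G {s | 0 ≤ s.re}) {η ε : ℝ} (hη : 0 < η) (hε : 0 < ε) :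
    ∀ᶠ x in atTop, ∃ t ∈ Set.Icc (x - η) (x + η), r t < ε := by
  have hM0 : 0 ≤ M := (abs_nonneg _).trans (hM 0)
  obtain ⟨T, hT0, hT⟩ : ∃ T : ℝ, 0 < T ∧
      0 < (ε + M) * (∫ u in (-T)..T, fejer u) - M * ∫ u, fejer u := by
    have h1 := intervalIntegral_tendsto_integral integrable_fejer tendsto_neg_atTop_atBot
      tendsto_id
    have h2 := (h1.const_mul (ε + M)).sub_const (M * ∫ u, fejer u)
    have h3 : 0 < (ε + M) * (∫ u, fejer u) - M * ∫ u, fejer u := by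
      have := mul_pos hε integral_fejer_pos
      linarith
    obtain ⟨T, h4, h5⟩ := ((h2.eventually (lt_mem_nhds h3)).and (eventually_gt_atTop 0)).exists
    exact ⟨T, h5, h4⟩
  set c := (ε + M) * (∫ u in (-T)..T, fejer u) - M * ∫ u, fejer u with hcdef
  -- Dilating by `l` carries the window of radius `η` to radius `T`, which holds enough of the
  -- kernel's mass.
  set l := T / η with hl
  have hl0 : 0 < l := by positivity
  have hlη : l * η = T := by rw [hl]; field_simp
  have key : Tendsto (fun x => ∫ t in Set.Ioi (0 : ℝ), r (l⁻¹ * t) * fejer (t - x)) atTop (𝓝 0) := by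
    refine tendsto_integral_mul_fejer (M := M) (G := fun s => l * G (l * s)) (by fun_prop)
      (fun t => hM _) (fun s hs => ?_) ?_
    · have h1 := integral_comp_mul_left_Ioi
        (fun t => (r t : ℂ) * Complex.exp (-(l * s * t))) 0 (inv_pos.2 hl0)
      rw [mul_zero, inv_inv, hG _ (by simpa using mul_pos hl0 hs), Complex.real_smul] at h1
      rw [← h1]
      refine integral_congr_ae (.of_forall fun t => ?_)
      simp only
      push_cast
      have : (l : ℂ) ≠ 0 := by exact_mod_cast hl0.ne'
      congr 3
      field_simp
    · refine continuousOn_const.mul (hc.comp (by fun_prop) fun s hs => ?_)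
      simpa using mul_nonneg hl0.le hs
  have hkey := ((key.comp (tendsto_id.const_mul_atTop hl0)).eventually (gt_mem_nhds hT))
  filter_upwards [hkey, eventually_gt_atTop η] with x hx hxη
  by_contra! hcon
  refine absurd hx (not_lt.2 ?_)
  simp only [Function.comp_apply, id]
  have hK : Integrable (fun t => fejer (t - l * x)) := integrable_fejer.comp_sub_right _
  have hsub : Set.Ioc (l * x - T) (l * x + T) ⊆ Set.Ioi 0 := fun t ht => by
    have : 0 < l * (x - η) := mul_pos hl0 (by linarith)
    have := ht.1
    simp only [Set.mem_Ioi]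
    linarith
  have e1 : ∫ t in Set.Ioi (0 : ℝ), (Set.Ioc (l * x - T) (l * x + T)).indicator
      (fun t => (ε + M) * fejer (t - l * x)) t = (ε + M) * ∫ u in (-T)..T, fejer u := by
    rw [setIntegral_indicator measurableSet_Ioc, Set.inter_eq_right.2 hsub, integral_const_mul,
      ← intervalIntegral.integral_of_le (by linarith), intervalIntegral.integral_comp_sub_right]
    congr 3 <;> ring
  have e2 : ∫ t in Set.Ioi (0 : ℝ), M * fejer (t - l * x) ≤ M * ∫ u, fejer u := by
    rw [integral_const_mul, ← integral_sub_right_eq_self fejer (l * x)]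
    exact mul_le_mul_of_nonneg_left
      (setIntegral_le_integral hK (.of_forall fun t => fejer_nonneg _)) hM0
  have i1 : Integrable ((Set.Ioc (l * x - T) (l * x + T)).indicator
      (fun t => (ε + M) * fejer (t - l * x))) := (hK.const_mul _).indicator measurableSet_Ioc
  have hm : Measurable fejer := continuous_fejer.measurable
  have i3 : Integrable (fun t => r (l⁻¹ * t) * fejer (t - l * x)) := by
    refine (hK.const_mul M).mono' (Measurable.aestronglyMeasurable (by fun_prop))
      (.of_forall fun t => ?_)
    rw [norm_mul, Real.norm_of_nonneg (fejer_nonneg _)]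
    exact mul_le_mul_of_nonneg_right (hM _) (fejer_nonneg _)
  -- Inside the window $r\ge\varepsilon=(\varepsilon+M)-M$; outside, only $r\ge -M$ is used.
  calc c ≤ ∫ t in Set.Ioi (0 : ℝ), ((Set.Ioc (l * x - T) (l * x + T)).indicator
      (fun t => (ε + M) * fejer (t - l * x)) t - M * fejer (t - l * x)) := by
        rw [integral_sub i1.integrableOn (hK.const_mul M).integrableOn, e1]
        linarith
    _ ≤ _ := by
        refine integral_mono (i1.sub (hK.const_mul M)).integrableOn i3.integrableOn fun t => ?_
        have hf := fejer_nonneg (t - l * x)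
        by_cases ht : t ∈ Set.Ioc (l * x - T) (l * x + T)
        · have h1 : ε ≤ r (l⁻¹ * t) := by
            refine hcon _ ⟨?_, ?_⟩
            · rw [inv_mul_eq_div, le_div_iff₀ hl0]; linarith [ht.1]
            · rw [inv_mul_eq_div, div_le_iff₀ hl0]; linarith [ht.2]
          simp only [Set.indicator_of_mem ht]
          nlinarith
        · simp only [Set.indicator_of_notMem ht]
          nlinarith [neg_le_of_abs_le (hM (l⁻¹ * t))]

/-- A Wiener–Ikehara theorem for bounded functions. -/
theorem tendsto_one_of_laplace {f : ℝ → ℝ} {M : ℝ} {G : ℂ → ℂ} (hf : Measurable f)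
    (hM : ∀ t, |f t - 1| ≤ M) (hmono : Monotone fun t => f t * Real.exp t)
    (hG : ∀ s : ℂ, 0 < s.re →
      ∫ t in Set.Ioi (0 : ℝ), ((f t - 1 : ℝ) : ℂ) * Complex.exp (-(s * t)) = G s)
    (hc : ContinuousOn G {s | 0 ≤ s.re}) : Tendsto f atTop (𝓝 1) := by
  have hle : ∀ {x t : ℝ}, x ≤ t → f x ≤ f t * Real.exp (t - x) := fun {x t} h => by
    rw [Real.exp_sub, mul_div_assoc', le_div_iff₀ (Real.exp_pos _)]
    exact hmono h
  refine tendsto_order.2 ⟨fun a ha => ?_, fun a ha => ?_⟩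
  · obtain ⟨b, hab, hb⟩ := exists_between ha
    obtain ⟨η, hη, h1⟩ : ∃ η > 0, ∀ v ∈ Set.Icc 0 (2 * η), a * Real.exp v < b := by
      have h2 : ∀ᶠ v in 𝓝 (0 : ℝ), a * Real.exp v < b := by
        have : Continuous fun v : ℝ => a * Real.exp v := by fun_prop
        exact (this.tendsto 0).eventually (gt_mem_nhds (by simpa using hab))
      obtain ⟨δ, hδ, h3⟩ := Metric.eventually_nhds_iff.1 h2
      refine ⟨δ / 4, by positivity, fun v hv => h3 ?_⟩
      rw [Real.dist_0_eq_abs, abs_of_nonneg hv.1]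
      linarith [hv.2]
    -- Used at centre $x-\eta$, this gives $t\in[x-2\eta,x]$ with $f(t)>b$; but $f(x)\le a$ would
    -- force $f(t)\le ae^{x-t}<b$.
    have h4 := eventually_exists_lt_of_laplace (r := fun t => -(f t - 1)) (G := fun s => -G s)
      (by fun_prop) (by simpa only [abs_neg] using hM) (fun s hs => by
        rw [← hG s hs, ← integral_neg]
        push_cast
        simp only [neg_mul]) hc.neg hη (sub_pos.2 hb)
    filter_upwards [(tendsto_atTop_add_const_right _ (-η) tendsto_id).eventually h4]
      with x ⟨t, ht, hlt⟩
    simp only [id] at ht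
    by_contra! hfx
    have h5 := hle (show t ≤ x by linarith [ht.2])
    have h6 := h1 (x - t) ⟨by linarith [ht.2], by linarith [ht.1]⟩
    have h7 := mul_le_mul_of_nonneg_right hfx (Real.exp_pos (x - t)).le
    linarith
  · obtain ⟨b, hb, hba⟩ := exists_between ha
    obtain ⟨η, hη, h1⟩ : ∃ η > 0, ∀ v ∈ Set.Icc 0 (2 * η), b * Real.exp v < a := by
      have h2 : ∀ᶠ v in 𝓝 (0 : ℝ), b * Real.exp v < a := by
        have : Continuous fun v : ℝ => b * Real.exp v := by fun_prop
        exact (this.tendsto 0).eventually (gt_mem_nhds (by simpa using hba))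
      obtain ⟨δ, hδ, h3⟩ := Metric.eventually_nhds_iff.1 h2
      refine ⟨δ / 4, by positivity, fun v hv => h3 ?_⟩
      rw [Real.dist_0_eq_abs, abs_of_nonneg hv.1]
      linarith [hv.2]
    -- Here the centre is $x+\eta$: some $t\in[x,x+2\eta]$ has $f(t)<b$, so $f(x)\le be^{t-x}<a$.
    have h4 := eventually_exists_lt_of_laplace (r := fun t => f t - 1) (by fun_prop) hM hG hc hη
      (sub_pos.2 hb)
    filter_upwards [(tendsto_atTop_add_const_right _ η tendsto_id).eventually h4]
      with x ⟨t, ht, hlt⟩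
    simp only [id] at ht
    have h5 := hle (show x ≤ t by linarith [ht.1])
    have h6 := h1 (t - x) ⟨by linarith [ht.1], by linarith [ht.2]⟩
    have h7 := mul_le_mul_of_nonneg_right (show f t ≤ b by linarith) (Real.exp_pos (t - x)).le
    linarith

/-! ### Laplace transforms and the prime number theorem -/

/-- The L-series of a nonnegative sequence as a Laplace transform. -/
theorem LSeries_eq_mul_laplace {c : ℕ → ℝ} {r : ℝ} (hr : 0 ≤ r) {s : ℂ} (hs : r < s.re)
    (hO : (fun n : ℕ => ∑ k ∈ Finset.Icc 1 n, c k) =O[atTop] fun n => (n : ℝ) ^ r)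
    (hc : ∀ n, 0 ≤ c n) :
    LSeries (fun n => (c n : ℂ)) s = s * ∫ t in Set.Ioi (0 : ℝ),
      ((∑ k ∈ Finset.Icc 1 ⌊Real.exp t⌋₊, c k : ℝ) : ℂ) * Complex.exp (-(s * t)) := by
  rw [LSeries_eq_mul_integral_of_nonneg c hr hs hO hc]
  have h := integral_comp_exp_Ioi (fun t : ℝ =>
    (∑ k ∈ Finset.Icc 1 ⌊t⌋₊, (c k : ℂ)) * (t : ℂ) ^ (-(s + 1))) 0
  rw [Real.exp_zero] at h
  rw [← h]
  congr 1
  refine integral_congr_ae (.of_forall fun t => ?_)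
  simp only [Complex.real_smul]
  have h1 : ((Real.exp t : ℝ) : ℂ) ≠ 0 := by exact_mod_cast (Real.exp_pos t).ne'
  rw [Complex.cpow_def_of_ne_zero h1, ← Complex.ofReal_log (Real.exp_pos t).le, Real.log_exp,
    Complex.ofReal_exp, mul_left_comm, ← Complex.exp_add]
  push_cast
  ring_nf

open ArithmeticFunction in
theorem psi_eq_sum_Icc_one (x : ℝ) :
    Chebyshev.psi x = ∑ k ∈ Finset.Icc 1 ⌊x⌋₊, vonMangoldt k := by
  rw [Chebyshev.psi]; rfl

theorem psi_exp_mul_exp_neg_mem (t : ℝ) :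
    Chebyshev.psi (Real.exp t) * Real.exp (-t) ∈ Set.Icc 0 (Real.log 4 + 4) := by
  refine ⟨mul_nonneg (Chebyshev.psi_nonneg _) (Real.exp_pos _).le, ?_⟩
  rw [Real.exp_neg, ← div_eq_mul_inv, div_le_iff₀ (Real.exp_pos t)]
  exact Chebyshev.psi_le_const_mul_self (Real.exp_pos t).le

open ArithmeticFunction in
-- Modulo 1 there is a single residue class, so this is the case $q=1$ of the Dirichlet
-- decomposition. The auxiliary function is continuous on $\Re s\ge1$, which is where non-vanishing
-- of $\zeta$ on that line enters.
theorem LSeries_vonMangoldt_sub_eq {s : ℂ} (hs : 1 < s.re) :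
    LSeries (fun n => (vonMangoldt n : ℂ)) s =
      vonMangoldt.LFunctionResidueClassAux (1 : ZMod 1) s + 1 / (s - 1) := by
  have h := vonMangoldt.eqOn_LFunctionResidueClassAux (q := 1) (a := 1) isUnit_one hs
  have h2 : (fun n : ℕ => (vonMangoldt.residueClass (1 : ZMod 1) n : ℂ)) =
      fun n => (vonMangoldt n : ℂ) := by
    ext n
    rw [vonMangoldt.residueClass, Set.indicator_of_mem]
    exact Subsingleton.elim _ _
  simp only [h2] at h
  rw [h]
  simp

open ArithmeticFunction in
-- The poles at $s=0$ cancel: $\frac1{s(1+s)}-\frac1s=-\frac1{1+s}$.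
theorem laplace_psi {s : ℂ} (hs : 0 < s.re) :
    ∫ t in Set.Ioi (0 : ℝ), ((Chebyshev.psi (Real.exp t) * Real.exp (-t) - 1 : ℝ) : ℂ) *
      Complex.exp (-(s * t)) =
      (vonMangoldt.LFunctionResidueClassAux (1 : ZMod 1) (1 + s) - 1) / (1 + s) := by
  have hs1 : 1 < (1 + s).re := by simpa using hs
  have hO : (fun n : ℕ => ∑ k ∈ Finset.Icc 1 n, vonMangoldt k) =O[atTop]
      fun n => (n : ℝ) ^ (1 : ℝ) := by
    refine Asymptotics.IsBigO.of_bound (Real.log 4 + 4) (.of_forall fun n => ?_)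
    have h1 := psi_eq_sum_Icc_one n
    rw [Nat.floor_natCast] at h1
    rw [← h1, Real.norm_of_nonneg (Chebyshev.psi_nonneg _), Real.rpow_one,
      Real.norm_of_nonneg n.cast_nonneg]
    exact Chebyshev.psi_le_const_mul_self n.cast_nonneg
  have h1 := LSeries_eq_mul_laplace zero_le_one hs1 hO fun n => vonMangoldt_nonneg
  simp only [← psi_eq_sum_Icc_one] at h1
  rw [LSeries_vonMangoldt_sub_eq hs1] at h1
  have hexp : IntegrableOn (fun t : ℝ => Complex.exp (-s * t)) (Set.Ioi 0) :=
    integrableOn_exp_mul_complex_Ioi (by simpa using hs) 0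
  have hi : IntegrableOn (fun t : ℝ => ((Chebyshev.psi (Real.exp t) * Real.exp (-t) : ℝ) : ℂ) *
      Complex.exp (-s * t)) (Set.Ioi 0) := by
    refine Integrable.bdd_mul (c := Real.log 4 + 4) hexp ?_ (.of_forall fun t => ?_)
    · have := Chebyshev.psi_mono.measurable
      exact Measurable.aestronglyMeasurable (by fun_prop)
    · rw [Complex.norm_real, Real.norm_of_nonneg (psi_exp_mul_exp_neg_mem t).1]
      exact (psi_exp_mul_exp_neg_mem t).2
  have h2 : ∀ t : ℝ, ((Chebyshev.psi (Real.exp t) * Real.exp (-t) - 1 : ℝ) : ℂ) *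
      Complex.exp (-(s * t)) = ((Chebyshev.psi (Real.exp t) * Real.exp (-t) : ℝ) : ℂ) *
      Complex.exp (-s * t) - Complex.exp (-s * t) := fun t => by
    push_cast
    ring_nf
  simp_rw [h2]
  rw [integral_sub hi hexp, integral_exp_mul_complex_Ioi (by simpa using hs)]
  have h3 : ∫ t in Set.Ioi (0 : ℝ), ((Chebyshev.psi (Real.exp t) * Real.exp (-t) : ℝ) : ℂ) *
      Complex.exp (-s * t) = ∫ t in Set.Ioi (0 : ℝ), ((Chebyshev.psi (Real.exp t) : ℝ) : ℂ) *
      Complex.exp (-((1 + s) * t)) := by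
    refine integral_congr_ae (.of_forall fun t => ?_)
    simp only
    push_cast
    rw [mul_assoc, ← Complex.exp_add]
    ring_nf
  rw [h3]
  have hs0 : s ≠ 0 := fun h => by simp [h] at hs
  have hs0' : 1 + s ≠ 0 := fun h => by rw [h] at hs1; simp at hs1; linarith
  rw [add_sub_cancel_left] at h1
  simp only [Complex.ofReal_zero, mul_zero, Complex.exp_zero]
  field_simp
  field_simp at h1
  linear_combination -h1

/-- The prime number theorem for `ψ`. -/
theorem tendsto_psi_exp : Tendsto (fun t : ℝ => Chebyshev.psi (Real.exp t) * Real.exp (-t))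
    atTop (𝓝 1) := by
  have hm := Chebyshev.psi_mono.measurable
  refine tendsto_one_of_laplace (M := Real.log 4 + 4) (by fun_prop) (fun t => ?_) ?_
    (fun s hs => laplace_psi hs) ?_
  · have h := psi_exp_mul_exp_neg_mem t
    have : 0 < Real.log 4 := Real.log_pos (by norm_num)
    rw [abs_le]
    constructor <;> linarith [h.1, h.2]
  · intro a b h
    simp only [mul_assoc, ← Real.exp_add, neg_add_cancel, Real.exp_zero, mul_one]
    exact Chebyshev.psi_mono (Real.exp_le_exp.2 h)
  · refine ContinuousOn.div (ContinuousOn.sub ?_ continuousOn_const) (by fun_prop) ?_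
    · refine (ArithmeticFunction.vonMangoldt.continuousOn_LFunctionResidueClassAux
        (1 : ZMod 1)).comp (by fun_prop) fun s hs => ?_
      simpa using hs
    · intro s hs h
      have := congrArg Complex.re h
      simp at this hs
      linarith

theorem tendsto_psi_div : Tendsto (fun x : ℝ => Chebyshev.psi x / x) atTop (𝓝 1) := by
  refine (tendsto_psi_exp.comp Real.tendsto_log_atTop).congr' ?_
  filter_upwards [eventually_gt_atTop 0] with x hx
  rw [Function.comp_apply, Real.exp_neg, Real.exp_log hx, div_eq_mul_inv]

/-- The prime number theorem for `θ`. -/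
theorem tendsto_theta_div : Tendsto (fun x : ℝ => Chebyshev.theta x / x) atTop (𝓝 1) := by
  have h1 : Tendsto (fun x : ℝ => (Chebyshev.psi x - Chebyshev.theta x) / x) atTop (𝓝 0) := by
    refine (Chebyshev.isBigO_psi_sub_theta_sqrt.trans_isLittleO ?_).tendsto_div_nhds_zero
    refine Asymptotics.isLittleO_of_tendsto' ?_ ?_
    · filter_upwards [eventually_ne_atTop 0] with x hx h0 using absurd h0 hx
    · simp_rw [Real.sqrt_div_self]
      exact Real.tendsto_sqrt_atTop.inv_tendsto_atTop
  have h2 := tendsto_psi_div.sub h1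
  rw [sub_zero] at h2
  exact h2.congr fun x => by ring

/-! ### Mertens' theorems up to the constant -/

section Mertens

open ArithmeticFunction in
-- Sum $\Lambda*1=\log$ over $1,\dots,n$.
theorem sum_vonMangoldt_mul_div_eq_log_factorial (n : ℕ) :
    ∑ k ∈ Finset.Ioc 0 n, vonMangoldt k * ((n / k : ℕ) : ℝ) = Real.log n.factorial := by
  rw [← sum_Ioc_mul_zeta_eq_sum, vonMangoldt_mul_zeta]
  induction n with
  | zero => simp
  | succ n ih =>
    rw [Finset.sum_Ioc_succ_top (Nat.zero_le n), ih, log_apply, Nat.factorial_succ, Nat.cast_mul,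
      Real.log_mul (by positivity) (by positivity), add_comm]

open ArithmeticFunction in
-- Replacing $\lfloor n/k\rfloor$ by $n/k$ in $\log n!$ costs at most $\psi(n)=O(n)$, and $\log
-- n!=n\log n+O(n)$; divide by $n$.
theorem abs_sum_vonMangoldt_div_sub_log_le {n : ℕ} (hn : n ≠ 0) :
    |∑ k ∈ Finset.Ioc 0 n, vonMangoldt k / k - Real.log n| ≤ Real.log 4 + 4 := by
  have hn0 : (0 : ℝ) < n := by positivity
  have h4 : 0 < Real.log 4 := Real.log_pos (by norm_num)
  have h0 := sum_vonMangoldt_mul_div_eq_log_factorial n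
  have h1 : ∑ k ∈ Finset.Ioc 0 n, vonMangoldt k * ((n / k : ℕ) : ℝ) ≤
      n * ∑ k ∈ Finset.Ioc 0 n, vonMangoldt k / k := by
    rw [Finset.mul_sum]
    refine Finset.sum_le_sum fun k _ => ?_
    have := mul_le_mul_of_nonneg_left (Nat.cast_div_le (m := n) (n := k) (α := ℝ))
      (vonMangoldt_nonneg (n := k))
    exact this.trans_eq (by ring)
  have h2 : n * ∑ k ∈ Finset.Ioc 0 n, vonMangoldt k / k - Chebyshev.psi n ≤
      ∑ k ∈ Finset.Ioc 0 n, vonMangoldt k * ((n / k : ℕ) : ℝ) := by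
    rw [Chebyshev.psi, Nat.floor_natCast, Finset.mul_sum, ← Finset.sum_sub_distrib]
    refine Finset.sum_le_sum fun k _ => ?_
    have h3 : (n : ℝ) / k - 1 ≤ ((n / k : ℕ) : ℝ) := by
      rw [← Nat.floor_div_eq_div (K := ℝ)]
      exact (Nat.sub_one_lt_floor _).le
    have := mul_le_mul_of_nonneg_left h3 (vonMangoldt_nonneg (n := k))
    exact le_trans (le_of_eq (by ring)) this
  have h3 := Chebyshev.psi_le_const_mul_self hn0.le
  have h5 : Real.log n.factorial ≤ n * Real.log n := by
    rw [← Real.log_pow]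
    exact Real.log_le_log (by positivity) (by exact_mod_cast Nat.factorial_le_pow n)
  have h6 := Stirling.le_log_factorial_stirling hn
  have h7 : 0 ≤ Real.log n := Real.log_natCast_nonneg n
  have h8 : 0 ≤ Real.log (2 * Real.pi) := Real.log_nonneg (by linarith [Real.pi_gt_three])
  rw [abs_le]
  constructor
  · refine le_of_mul_le_mul_left ?_ hn0
    nlinarith
  · refine le_of_mul_le_mul_left ?_ hn0
    nlinarith

/-- Mertens' first theorem. -/
theorem exists_abs_sum_prime_log_div_sub_log_le : ∃ C : ℝ, ∀ t : ℝ, 1 ≤ t →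
    |∑ k ∈ Finset.Icc 0 ⌊t⌋₊, (if k.Prime then Real.log k / k else 0) - Real.log t| ≤ C := by
  have hs := ArithmeticFunction.vonMangoldt.summable_residueClass_non_primes_div (1 : ZMod 1)
  have hc : ∀ n, ArithmeticFunction.vonMangoldt.residueClass (1 : ZMod 1) n =
      ArithmeticFunction.vonMangoldt n := fun n => by
    rw [ArithmeticFunction.vonMangoldt.residueClass, Set.indicator_of_mem]
    exact Subsingleton.elim _ _
  simp only [hc] at hs
  set d : ℕ → ℝ := fun n => (if n.Prime then 0 else ArithmeticFunction.vonMangoldt n) / n with hd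
  have hd0 : ∀ n, 0 ≤ d n := fun n => by
    simp only [hd]
    split_ifs
    · simp
    · exact div_nonneg ArithmeticFunction.vonMangoldt_nonneg n.cast_nonneg
  -- The series is the contribution of proper prime powers; $\log 2$ covers passing from $\lfloor
  -- t\rfloor$ to $t\le2\lfloor t\rfloor$.
  refine ⟨Real.log 4 + 4 + (∑' n, d n) + Real.log 2, fun t ht => ?_⟩
  have hn : ⌊t⌋₊ ≠ 0 := (Nat.floor_pos.2 ht).ne'
  have h1 := abs_le.1 (abs_sum_vonMangoldt_div_sub_log_le hn)
  have h2 : ∑ k ∈ Finset.Icc 0 ⌊t⌋₊, (if k.Prime then Real.log k / k else 0) =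
      ∑ k ∈ Finset.Ioc 0 ⌊t⌋₊, ArithmeticFunction.vonMangoldt k / k -
        ∑ k ∈ Finset.Ioc 0 ⌊t⌋₊, d k := by
    rw [← Finset.sum_sub_distrib, ← Finset.add_sum_Ioc_eq_sum_Icc (Nat.zero_le _)]
    simp only [Nat.not_prime_zero, if_false, zero_add]
    refine Finset.sum_congr rfl fun k _ => ?_
    simp only [hd]
    split_ifs with hk
    · simp [ArithmeticFunction.vonMangoldt_apply_prime hk]
    · simp
  have h3 : ∑ k ∈ Finset.Ioc 0 ⌊t⌋₊, d k ≤ ∑' n, d n := hs.sum_le_tsum _ fun n _ => hd0 n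
  have h4 : 0 ≤ ∑ k ∈ Finset.Ioc 0 ⌊t⌋₊, d k := Finset.sum_nonneg fun n _ => hd0 n
  have hf0 : (1 : ℝ) ≤ ⌊t⌋₊ := by exact_mod_cast Nat.floor_pos.2 ht
  have h5 : Real.log ⌊t⌋₊ ≤ Real.log t :=
    Real.log_le_log (by linarith) (Nat.floor_le (by linarith))
  have h6 : Real.log t ≤ Real.log 2 + Real.log ⌊t⌋₊ := by
    rw [← Real.log_mul (by norm_num) (by linarith)]
    exact Real.log_le_log (by linarith) (by linarith [Nat.lt_floor_add_one t])
  have h7 : 0 < Real.log 2 := Real.log_pos (by norm_num)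
  rw [h2, abs_le]
  constructor <;> linarith [h1.1, h1.2]

theorem hasDerivAt_inv_log {t : ℝ} (ht : 2 ≤ t) :
    HasDerivAt (fun t => (Real.log t)⁻¹) (-(t⁻¹ / Real.log t ^ 2)) t := by
  have h := (Real.hasDerivAt_log (by linarith : t ≠ 0)).inv (Real.log_pos (by linarith)).ne'
  rwa [neg_div] at h

theorem integrableOn_inv_div_log_sq :
    IntegrableOn (fun t : ℝ => t⁻¹ / Real.log t ^ 2) (Set.Ioi 2) := by
  refine integrableOn_Ioi_deriv_of_nonneg' (g := fun t => -(Real.log t)⁻¹) (l := -0)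
    (fun t ht => ?_) (fun t ht => ?_) Real.tendsto_log_atTop.inv_tendsto_atTop.neg
  · have h := (hasDerivAt_inv_log ht).neg
    rw [neg_neg] at h
    exact h
  · have : (0 : ℝ) < t := lt_trans two_pos ht
    positivity

theorem hasDerivAt_log_log {t : ℝ} (ht : 2 ≤ t) :
    HasDerivAt (fun t => Real.log (Real.log t)) (t⁻¹ / Real.log t) t :=
  (Real.hasDerivAt_log (by linarith : t ≠ 0)).log (Real.log_pos (by linarith)).ne'

/-- Mertens' second theorem, without the value of the constant. -/
theorem exists_tendsto_sum_prime_inv_sub_log_log : ∃ C : ℝ, Tendsto (fun t : ℝ =>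
    ∑ k ∈ Finset.Icc 0 ⌊t⌋₊, (if k.Prime then (k : ℝ)⁻¹ else 0) - Real.log (Real.log t))
    atTop (𝓝 C) := by
  obtain ⟨B, hB⟩ := exists_abs_sum_prime_log_div_sub_log_le
  set c : ℕ → ℝ := fun k => if k.Prime then Real.log k / k else 0 with hc
  set A : ℝ → ℝ := fun t => ∑ k ∈ Finset.Icc 0 ⌊t⌋₊, c k with hA
  have hAm : Measurable A :=
    (measurable_from_nat (f := fun n : ℕ => ∑ k ∈ Finset.Icc 0 n, c k)).comp Nat.measurable_floor
  have hd : ∀ t ∈ Set.Ici (2 : ℝ), deriv (fun t => (Real.log t)⁻¹) t = -(t⁻¹ / Real.log t ^ 2) :=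
    fun t ht => (hasDerivAt_inv_log ht).deriv
  have hE : IntegrableOn (fun t => t⁻¹ / Real.log t ^ 2 * (A t - Real.log t)) (Set.Ioi 2) := by
    refine Integrable.mul_bdd (c := B) integrableOn_inv_div_log_sq
      (Measurable.aestronglyMeasurable (by fun_prop)) ?_
    filter_upwards [ae_restrict_mem measurableSet_Ioi] with t ht
    exact hB t (by have := Set.mem_Ioi.1 ht; linarith)
  -- Partial summation gives $A(x)/\log x+\int_2^x A(t)\,dt/(t\log^2t)$. The first term tends to
  -- $1$; putting $A=\log+(A-\log)$ in the second leaves $\log\log x-\log\log2$ and a convergent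
  -- integral.
  refine ⟨1 + (∫ t in Set.Ioi 2, t⁻¹ / Real.log t ^ 2 * (A t - Real.log t)) -
    Real.log (Real.log 2), ?_⟩
  have l1 : Tendsto (fun t => (Real.log t)⁻¹ * A t) atTop (𝓝 1) := by
    have : Tendsto (fun t => (Real.log t)⁻¹ * (A t - Real.log t)) atTop (𝓝 0) := by
      refine Tendsto.zero_mul_isBoundedUnder_le Real.tendsto_log_atTop.inv_tendsto_atTop ?_
      refine ⟨B, eventually_map.2 ?_⟩
      filter_upwards [eventually_ge_atTop 1] with t ht using hB t ht
    have h2 := this.add_const 1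
    rw [zero_add] at h2
    refine h2.congr' ?_
    filter_upwards [eventually_gt_atTop 1] with t ht
    have := (Real.log_pos ht).ne'
    field_simp
    ring
  have l2 := intervalIntegral_tendsto_integral_Ioi 2 hE tendsto_id
  have l3 := (l1.add l2).sub_const (Real.log (Real.log 2))
  refine l3.congr' ?_
  filter_upwards [eventually_ge_atTop 2] with x hx
  -- Since $c(0)=c(1)=0$, the integral may start at $2$, away from the singularity of $1/\log t$ at
  -- $1$.
  have e1 := sum_mul_eq_sub_integral_mul₁ c (f := fun t => (Real.log t)⁻¹) (by simp [hc])
    (by simp [hc, Nat.not_prime_one]) x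
    (fun t ht => (hasDerivAt_inv_log ht.1).differentiableAt) (by
      refine IntegrableOn.congr_fun (f := fun t => -(t⁻¹ / Real.log t ^ 2)) ?_
        (fun t ht => (hd t ht.1).symm) measurableSet_Icc
      exact (((integrableOn_Ici_iff_integrableOn_Ioi (by simp)).2 integrableOn_inv_div_log_sq).mono_set
        Set.Icc_subset_Ici_self).neg)
  have e2 : ∀ k : ℕ, (Real.log k)⁻¹ * c k = if k.Prime then (k : ℝ)⁻¹ else 0 := fun k => by
    simp only [hc]
    split_ifs with hk
    · have := (Real.log_pos (by exact_mod_cast hk.one_lt : (1 : ℝ) < k)).ne'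
      field_simp
    · simp
  simp only [e2] at e1
  rw [e1]
  have i1 : IntervalIntegrable (fun t => t⁻¹ / Real.log t) volume 2 x := by
    refine ContinuousOn.intervalIntegrable fun t ht => ContinuousAt.continuousWithinAt ?_
    rw [Set.uIcc_of_le hx] at ht
    have h1 : t ≠ 0 := by linarith [ht.1]
    have h2 := (Real.log_pos (by linarith [ht.1] : 1 < t)).ne'
    fun_prop (disch := assumption)
  have i2 : IntervalIntegrable (fun t => t⁻¹ / Real.log t ^ 2 * (A t - Real.log t)) volume 2 x :=
    (intervalIntegrable_iff_integrableOn_Ioc_of_le hx).2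
      (hE.mono_set Set.Ioc_subset_Ioi_self)
  have e3 : ∫ t in Set.Ioc 2 x, deriv (fun t => (Real.log t)⁻¹) t * A t =
      -(∫ t in (2 : ℝ)..x, t⁻¹ / Real.log t ^ 2 * (A t - Real.log t)) -
        ∫ t in (2 : ℝ)..x, t⁻¹ / Real.log t := by
    rw [← intervalIntegral.integral_of_le hx, ← intervalIntegral.integral_neg,
      ← intervalIntegral.integral_sub
        (f := fun t => -(t⁻¹ / Real.log t ^ 2 * (A t - Real.log t))) i2.neg i1]
    refine intervalIntegral.integral_congr fun t ht => ?_
    rw [Set.uIcc_of_le hx] at ht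
    simp only [hd t ht.1]
    have h2 := (Real.log_pos (by linarith [ht.1] : 1 < t)).ne'
    field_simp
    ring
  have e4 : ∫ t in (2 : ℝ)..x, t⁻¹ / Real.log t =
      Real.log (Real.log x) - Real.log (Real.log 2) := by
    refine intervalIntegral.integral_eq_sub_of_hasDerivAt
      (f := fun t => Real.log (Real.log t)) (fun t ht => ?_) i1
    rw [Set.uIcc_of_le hx] at ht
    exact hasDerivAt_log_log ht.1
  rw [e3, e4]
  simp only [id, hA]
  ring

theorem le_neg_log_one_sub {x : ℝ} (h1 : x ≤ 1 / 2) : x ≤ -Real.log (1 - x) := by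
  have := Real.log_le_sub_one_of_pos (by linarith : 0 < 1 - x)
  linarith

theorem neg_log_one_sub_le {x : ℝ} (h0 : 0 ≤ x) (h1 : x ≤ 1 / 2) :
    -Real.log (1 - x) ≤ x + 2 * x ^ 2 := by
  have h := Real.abs_log_sub_add_sum_range_le (x := x) (by rw [abs_of_nonneg h0]; linarith) 1
  rw [abs_of_nonneg h0] at h
  have h2 : x ^ (1 + 1) / (1 - x) ≤ 2 * x ^ 2 := by
    rw [div_le_iff₀ (by linarith), one_add_one_eq_two]
    nlinarith [mul_nonneg (sq_nonneg x) (sub_nonneg.2 h1)]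
  have := (abs_le.1 (h.trans h2)).1
  simp at this
  linarith

/-- The logarithm of the Euler factor at `1` on primes, extended by zero. -/
noncomputable def primeLog (k : ℕ) : ℝ := if k.Prime then -Real.log (1 - (k : ℝ)⁻¹) else 0

theorem inv_prime_le_half {p : ℕ} (hp : p.Prime) : (p : ℝ)⁻¹ ≤ 1 / 2 := by
  rw [one_div]
  exact inv_anti₀ two_pos (by exact_mod_cast hp.two_le)

theorem primeLog_nonneg (k : ℕ) : 0 ≤ primeLog k := by
  rw [primeLog]
  split_ifs with hk
  · exact (inv_nonneg.2 k.cast_nonneg).trans (le_neg_log_one_sub (inv_prime_le_half hk))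
  · rfl

/-- Each term differs from $1/p$ by between $0$ and $2/p^2$, so the total correction converges. -/
theorem exists_tendsto_sum_primeLog_sub_log_log : ∃ C : ℝ, Tendsto (fun t : ℝ =>
    ∑ k ∈ Finset.Icc 0 ⌊t⌋₊, primeLog k - Real.log (Real.log t)) atTop (𝓝 C) := by
  obtain ⟨C, hC⟩ := exists_tendsto_sum_prime_inv_sub_log_log
  set d : ℕ → ℝ := fun k => primeLog k - if k.Prime then (k : ℝ)⁻¹ else 0 with hd
  have hs : Summable d := by
    refine Summable.of_nonneg_of_le (fun k => ?_) (fun k => ?_)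
      ((Real.summable_nat_pow_inv.2 one_lt_two).mul_left 2)
    · simp only [hd, primeLog]
      split_ifs with hk
      · exact sub_nonneg.2 (le_neg_log_one_sub (inv_prime_le_half hk))
      · simp
    · simp only [hd, primeLog]
      split_ifs with hk
      · have := neg_log_one_sub_le (inv_nonneg.2 k.cast_nonneg) (inv_prime_le_half hk)
        rw [← inv_pow]
        linarith
      · simp
  have h1 : Tendsto (fun t : ℝ => ∑ k ∈ Finset.Icc 0 ⌊t⌋₊, d k) atTop (𝓝 (∑' k, d k)) := by
    have := (hs.hasSum.tendsto_sum_nat.comp (tendsto_add_atTop_nat 1)).comp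
      (tendsto_nat_floor_atTop (α := ℝ))
    refine this.congr fun t => ?_
    simp only [Function.comp_apply, Finset.range_eq_Ico]
    rfl
  refine ⟨C + ∑' k, d k, (hC.add h1).congr fun t => ?_⟩
  simp only [hd, Finset.sum_sub_distrib]
  ring

end Mertens

/-! ### The constant in Mertens' theorem -/

section MertensConstant

/-- Differentiating the Gamma integral at $1$ gives $\Gamma'(1)=-\gamma_0$. -/
theorem integrableOn_log_mul_exp_neg :
    IntegrableOn (fun v : ℝ => Real.log v * Real.exp (-v)) (Set.Ioi 0) ∧
      ∫ v in Set.Ioi (0 : ℝ), Real.log v * Real.exp (-v) = -Real.eulerMascheroniConstant := by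
  have h1 : Complex.GammaIntegral =ᶠ[𝓝 1] Complex.Gamma := by
    have : {s : ℂ | 0 < s.re} ∈ 𝓝 (1 : ℂ) :=
      (isOpen_lt continuous_const Complex.continuous_re).mem_nhds (by simp)
    filter_upwards [this] with s hs using (Complex.Gamma_eq_integral hs).symm
  have h2 := (Complex.hasDerivAt_GammaIntegral (s := 1) (by simp)).unique
    (Complex.hasDerivAt_Gamma_one.congr_of_eventuallyEq h1)
  have h3 : ∫ v in Set.Ioi (0 : ℝ), Real.log v * Real.exp (-v) =
      -Real.eulerMascheroniConstant := by
    have h4 : ∫ v in Set.Ioi (0 : ℝ), ((Real.log v * Real.exp (-v) : ℝ) : ℂ) =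
        ((-Real.eulerMascheroniConstant : ℝ) : ℂ) := by
      push_cast
      simpa using h2
    rw [integral_complex_ofReal] at h4
    exact_mod_cast h4
  refine ⟨?_, h3⟩
  -- A non-integrable function has integral $0$ by convention, whereas $\gamma_0>1/2$.
  by_contra hn
  rw [integral_undef hn] at h3
  have := Real.one_half_lt_eulerMascheroniConstant
  linarith

/-- Convergence controls large $u$, monotonicity of the sum the rest; only $\log u$ near $0$ is
unbounded. This supplies the majorant for the limit $\delta\to0^+$. -/
theorem abs_sum_primeLog_exp_sub_log_le : ∃ B : ℝ, ∀ u : ℝ, 0 < u →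
    |∑ k ∈ Finset.Icc 0 ⌊Real.exp u⌋₊, primeLog k - Real.log u| ≤
      B + if u < 1 then |Real.log u| else 0 := by
  obtain ⟨C, hC⟩ := exists_tendsto_sum_primeLog_sub_log_log
  set P : ℝ → ℝ := fun u => ∑ k ∈ Finset.Icc 0 ⌊Real.exp u⌋₊, primeLog k with hP
  have hmono : Monotone P := fun a b h => Finset.sum_le_sum_of_subset_of_nonneg
    (Finset.Icc_subset_Icc_right (Nat.floor_mono (Real.exp_le_exp.2 h)))
    fun k _ _ => primeLog_nonneg k
  have hP0 : ∀ u, 0 ≤ P u := fun u => Finset.sum_nonneg fun k _ => primeLog_nonneg k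
  have h1 := (hC.comp Real.tendsto_exp_atTop).abs.eventually (gt_mem_nhds (lt_add_one (|C|)))
  obtain ⟨u₀, h2⟩ := eventually_atTop.1 h1
  set a := max u₀ 1 with ha
  have ha1 : 1 ≤ a := le_max_right _ _
  refine ⟨|C| + 1 + P a + Real.log a, fun u hu => ?_⟩
  have hla := Real.log_nonneg ha1
  rcases le_or_gt a u with h | h
  · have h3 := h2 u ((le_max_left _ _).trans h)
    simp only [Function.comp_apply, Real.log_exp] at h3
    rw [if_neg (by linarith)]
    linarith [hP0 a]
  · have h4 := hmono h.le
    refine (abs_sub _ _).trans ?_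
    change |P u| + _ ≤ _
    rw [abs_of_nonneg (hP0 u)]
    split_ifs with h5
    · linarith [abs_nonneg C]
    · rw [abs_of_nonneg (Real.log_nonneg (not_lt.1 h5))]
      have := Real.log_le_log hu h.le
      linarith [abs_nonneg C]

theorem sum_primeLog_isBigO {r : ℝ} (hr : 0 < r) :
    (fun n : ℕ => ∑ k ∈ Finset.Icc 1 n, primeLog k) =O[atTop] fun n => (n : ℝ) ^ r := by
  obtain ⟨C, hC⟩ := exists_tendsto_sum_primeLog_sub_log_log
  have h1 := (hC.comp tendsto_natCast_atTop_atTop).isBigO_one ℝ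
  have h2 : (fun _ : ℕ => (1 : ℝ)) =O[atTop] fun n : ℕ => (n : ℝ) ^ r := by
    refine Asymptotics.IsBigO.of_bound 1 ?_
    filter_upwards [eventually_ge_atTop 1] with n hn
    rw [one_mul, norm_one, Real.norm_of_nonneg (by positivity)]
    exact Real.one_le_rpow (by exact_mod_cast hn) hr.le
  have h3 : (fun n : ℕ => Real.log (Real.log n)) =O[atTop] fun n : ℕ => (n : ℝ) ^ r := by
    have h4 : (fun x : ℝ => Real.log (Real.log x)) =O[atTop] fun x : ℝ => x ^ r :=
      (Real.isLittleO_log_id_atTop.comp_tendsto Real.tendsto_log_atTop).isBigO.trans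
        (isLittleO_log_rpow_atTop hr).isBigO
    exact h4.comp_tendsto tendsto_natCast_atTop_atTop
  refine ((h1.trans h2).add h3).congr_left fun n => ?_
  simp only [Function.comp_apply, Nat.floor_natCast, sub_add_cancel]
  rw [← Finset.add_sum_Ioc_eq_sum_Icc (Nat.zero_le _)]
  simp [primeLog, Nat.not_prime_zero]
  rfl

/-- With $P(u)=\log u+C+o(1)$ the sum up to $e^u$, substituting $v=\delta t$ gives $\delta\int
P(t)e^{-\delta t}dt=\int P(v/\delta)e^{-v}dv$, and $\log(v/\delta)$ splits off $-\log\delta$ and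
$\int e^{-v}\log v\,dv=-\gamma_0$. -/
theorem tendsto_LSeries_primeLog_add_log {C : ℝ} (hC : Tendsto (fun t : ℝ =>
    ∑ k ∈ Finset.Icc 0 ⌊t⌋₊, primeLog k - Real.log (Real.log t)) atTop (𝓝 C)) :
    Tendsto (fun δ : ℝ => (LSeries (fun n => (primeLog n : ℂ)) δ).re + Real.log δ) (𝓝[>] 0)
      (𝓝 (C - Real.eulerMascheroniConstant)) := by
  obtain ⟨B, hB⟩ := abs_sum_primeLog_exp_sub_log_le
  obtain ⟨hli, hlog⟩ := integrableOn_log_mul_exp_neg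
  set P : ℝ → ℝ := fun u => ∑ k ∈ Finset.Icc 0 ⌊Real.exp u⌋₊, primeLog k with hP
  have hPm : Measurable P :=
    (measurable_from_nat (f := fun n : ℕ => ∑ k ∈ Finset.Icc 0 n, primeLog k)).comp
      (Nat.measurable_floor.comp Real.measurable_exp)
  have hei : IntegrableOn (fun v : ℝ => Real.exp (-v)) (Set.Ioi 0) := integrableOn_exp_neg_Ioi 0
  have hbi : IntegrableOn (fun v : ℝ => (B + |Real.log v|) * Real.exp (-v)) (Set.Ioi 0) := by
    refine ((hei.const_mul B).add hli.norm).congr (.of_forall fun v => ?_)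
    simp only [Pi.add_apply, norm_mul, Real.norm_eq_abs, Real.abs_exp]
    ring
  have hbound : ∀ δ ∈ Set.Ioo (0 : ℝ) 1, ∀ v ∈ Set.Ioi (0 : ℝ),
      ‖(P (δ⁻¹ * v) - Real.log (δ⁻¹ * v)) * Real.exp (-v)‖ ≤
        (B + |Real.log v|) * Real.exp (-v) := by
    intro δ hδ v hv
    have hv0 : 0 < v := hv
    have hv' : 0 < δ⁻¹ * v := mul_pos (inv_pos.2 hδ.1) hv0
    rw [norm_mul, Real.norm_eq_abs, Real.norm_of_nonneg (Real.exp_pos _).le]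
    refine mul_le_mul_of_nonneg_right ((hB _ hv').trans ?_) (Real.exp_pos _).le
    split_ifs with h
    -- Here $v\le v/\delta<1$, so $|\log(v/\delta)|\le|\log v|$, a bound free of `δ`.
    · have h1 : v ≤ δ⁻¹ * v := le_mul_of_one_le_left hv0.le (one_le_inv₀ hδ.1 |>.2 hδ.2.le)
      have h2 := Real.log_le_log hv0 h1
      have h3 := Real.log_nonpos hv'.le h.le
      rw [abs_of_nonpos h3, abs_of_nonpos (h2.trans h3)]
      linarith
    · linarith [abs_nonneg (Real.log v)]
  have hmeas : ∀ δ : ℝ, Measurable fun v : ℝ =>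
      (P (δ⁻¹ * v) - Real.log (δ⁻¹ * v)) * Real.exp (-v) := fun δ => by fun_prop
  have hev : ∀ᶠ δ : ℝ in 𝓝[>] 0, δ ∈ Set.Ioo (0 : ℝ) 1 := Ioo_mem_nhdsGT zero_lt_one
  have hlim : Tendsto (fun δ : ℝ => ∫ v in Set.Ioi (0 : ℝ),
      (P (δ⁻¹ * v) - Real.log (δ⁻¹ * v)) * Real.exp (-v)) (𝓝[>] 0)
      (𝓝 (∫ v in Set.Ioi (0 : ℝ), C * Real.exp (-v))) := by
    refine tendsto_integral_filter_of_dominated_convergence _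
      (.of_forall fun δ => (hmeas δ).aestronglyMeasurable) ?_ hbi ?_
    · filter_upwards [hev] with δ hδ
      filter_upwards [ae_restrict_mem measurableSet_Ioi] with v hv using hbound δ hδ v hv
    · filter_upwards [ae_restrict_mem measurableSet_Ioi] with v hv
      refine Tendsto.mul_const _ ?_
      have h1 : Tendsto (fun δ : ℝ => δ⁻¹ * v) (𝓝[>] 0) atTop :=
        tendsto_inv_nhdsGT_zero.atTop_mul_const hv
      have h2 := (hC.comp Real.tendsto_exp_atTop).comp h1
      refine h2.congr fun δ => ?_
      simp only [Function.comp_apply, Real.log_exp, hP]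
  rw [integral_const_mul, integral_exp_neg_Ioi_zero, mul_one] at hlim
  refine (hlim.sub_const Real.eulerMascheroniConstant).congr' ?_
  filter_upwards [hev] with δ hδ
  have hδ0 := hδ.1
  have e1 := LSeries_eq_mul_laplace (c := primeLog) (r := δ / 2) (by positivity) (s := δ)
    (by simpa using hδ0) (sum_primeLog_isBigO (by positivity)) primeLog_nonneg
  have e2 : LSeries (fun n => (primeLog n : ℂ)) δ =
      ((δ * ∫ t in Set.Ioi (0 : ℝ), P t * Real.exp (-(δ * t)) : ℝ) : ℂ) := by
    rw [e1, Complex.ofReal_mul, ← integral_complex_ofReal]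
    congr 1
    refine integral_congr_ae (.of_forall fun t => ?_)
    have : P t = ∑ k ∈ Finset.Icc 1 ⌊Real.exp t⌋₊, primeLog k := by
      simp only [hP]
      rw [← Finset.add_sum_Ioc_eq_sum_Icc (Nat.zero_le _)]
      simp only [primeLog, Nat.not_prime_zero, if_false, zero_add]
      rfl
    simp only [this]
    push_cast
    rfl
  have e3 := integral_comp_mul_left_Ioi' (fun v => P (δ⁻¹ * v) * Real.exp (-v)) 0 hδ0
  simp only [inv_mul_cancel_left₀ hδ0.ne', mul_zero, smul_eq_mul] at e3
  have i1 : IntegrableOn (fun v : ℝ => (P (δ⁻¹ * v) - Real.log (δ⁻¹ * v)) * Real.exp (-v))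
      (Set.Ioi 0) := by
    refine hbi.mono' (hmeas δ).aestronglyMeasurable ?_
    filter_upwards [ae_restrict_mem measurableSet_Ioi] with v hv using hbound δ hδ v hv
  have e4 : ∫ v in Set.Ioi (0 : ℝ), P (δ⁻¹ * v) * Real.exp (-v) =
      (∫ v in Set.Ioi (0 : ℝ), (P (δ⁻¹ * v) - Real.log (δ⁻¹ * v)) * Real.exp (-v)) +
        ∫ v in Set.Ioi (0 : ℝ),
          (Real.log v * Real.exp (-v) - Real.log δ * Real.exp (-v)) := by
    rw [← integral_add
      (g := fun v => Real.log v * Real.exp (-v) - Real.log δ * Real.exp (-v)) i1 (hli.sub (hei.const_mul _))]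
    refine setIntegral_congr_fun measurableSet_Ioi fun v hv => ?_
    rw [Real.log_mul (inv_pos.2 hδ0).ne' (ne_of_gt hv), Real.log_inv]
    ring
  rw [e2, Complex.ofReal_re, e3, e4, integral_sub hli (hei.const_mul _), hlog,
    integral_const_mul, integral_exp_neg_Ioi_zero]
  ring

theorem rpow_neg_one_add_eq {p : ℝ} (hp : 0 < p) (δ : ℝ) :
    p ^ (-(1 + δ)) = p⁻¹ * p ^ (-δ) := by
  rw [neg_add, Real.rpow_add hp, Real.rpow_neg_one]

theorem rpow_neg_mem_Icc {p δ : ℝ} (hp : 1 ≤ p) (hδ : 0 ≤ δ) : p ^ (-δ) ∈ Set.Icc (0 : ℝ) 1 :=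
  ⟨Real.rpow_nonneg (by linarith) _, Real.rpow_le_one_of_one_le_of_nonpos hp (by linarith)⟩

theorem prime_rpow_le_half {p : ℕ} (hp : p.Prime) {δ : ℝ} (hδ : 0 ≤ δ) :
    (p : ℝ) ^ (-(1 + δ)) ≤ 1 / 2 := by
  have h1 : (1 : ℝ) ≤ p := by exact_mod_cast hp.one_le
  rw [rpow_neg_one_add_eq (by linarith)]
  have h2 := rpow_neg_mem_Icc h1 hδ
  have h3 := inv_prime_le_half hp
  have h4 : (0 : ℝ) ≤ (p : ℝ)⁻¹ := by positivity
  nlinarith [h2.1, h2.2]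

theorem summable_neg_log_one_sub_prime_rpow {δ : ℝ} (hδ : 0 < δ) :
    Summable fun p : Nat.Primes => -Real.log (1 - (p : ℝ) ^ (-(1 + δ))) := by
  have h1 : Summable fun p : Nat.Primes => (p : ℝ) ^ (-(1 + δ)) :=
    Nat.Primes.summable_rpow.2 (by linarith)
  refine Summable.of_nonneg_of_le (fun p => ?_) (fun p => ?_) (h1.mul_left 2)
  · exact (Real.rpow_nonneg (Nat.cast_nonneg _) _).trans
      (le_neg_log_one_sub (prime_rpow_le_half p.2 hδ.le))
  · have h2 := prime_rpow_le_half p.2 hδ.le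
    have h3 : (0 : ℝ) ≤ (p : ℝ) ^ (-(1 + δ)) := Real.rpow_nonneg (Nat.cast_nonneg _) _
    have h4 := neg_log_one_sub_le h3 h2
    nlinarith

theorem primeLog_mul_rpow_bounds (p : Nat.Primes) {δ : ℝ} (hδ : 0 ≤ δ) :
    (p : ℝ) ^ (-(1 + δ)) ≤ primeLog p * (p : ℝ) ^ (-δ) ∧
      primeLog p * (p : ℝ) ^ (-δ) ≤ (p : ℝ) ^ (-(1 + δ)) + 2 * ((p : ℝ)⁻¹ ^ 2) := by
  have hp1 : (1 : ℝ) ≤ p := by exact_mod_cast p.2.one_le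
  have h1 := rpow_neg_mem_Icc hp1 hδ
  have h2 := inv_prime_le_half p.2
  have h3 := le_neg_log_one_sub h2
  have h4 := neg_log_one_sub_le (by positivity) h2
  rw [rpow_neg_one_add_eq (by linarith), primeLog, if_pos p.2]
  constructor
  · exact mul_le_mul_of_nonneg_right h3 h1.1
  · have h5 := mul_le_mul_of_nonneg_right h4 h1.1
    have h6 := mul_le_of_le_one_right (sq_nonneg ((p : ℝ)⁻¹)) h1.2
    nlinarith

theorem summable_primes_inv_sq : Summable fun p : Nat.Primes => ((p : ℝ)⁻¹ ^ 2) := by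
  have h : Summable fun p : Nat.Primes => (p : ℝ) ^ (-2 : ℝ) :=
    Nat.Primes.summable_rpow.2 (by norm_num)
  refine h.congr fun p => ?_
  rw [Real.rpow_neg (Nat.cast_nonneg _), Real.rpow_two, inv_pow]

theorem summable_primeLog_mul_rpow {δ : ℝ} (hδ : 0 < δ) :
    Summable fun p : Nat.Primes => primeLog p * (p : ℝ) ^ (-δ) := by
  have h1 : Summable fun p : Nat.Primes => (p : ℝ) ^ (-(1 + δ)) :=
    Nat.Primes.summable_rpow.2 (by linarith)
  exact Summable.of_nonneg_of_le
    (fun p => mul_nonneg (primeLog_nonneg _) (Real.rpow_nonneg (Nat.cast_nonneg _) _))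
    (fun p => (primeLog_mul_rpow_bounds p hδ.le).2) (h1.add (summable_primes_inv_sq.mul_left 2))

theorem LSeries_primeLog_re (δ : ℝ) :
    (LSeries (fun n => (primeLog n : ℂ)) δ).re =
      ∑' p : Nat.Primes, primeLog p * (p : ℝ) ^ (-δ) := by
  have h1 : ∀ n : ℕ, LSeries.term (fun n => (primeLog n : ℂ)) δ n =
      ((primeLog n * (n : ℝ) ^ (-δ) : ℝ) : ℂ) := fun n => by
    rcases eq_or_ne n 0 with rfl | hn
    · simp [primeLog, Nat.not_prime_zero]
    · rw [LSeries.term_of_ne_zero hn, Real.rpow_neg n.cast_nonneg, Complex.ofReal_mul,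
        Complex.ofReal_inv, Complex.ofReal_cpow n.cast_nonneg, div_eq_mul_inv,
        Complex.ofReal_natCast]
  simp only [LSeries, h1]
  rw [← Complex.ofReal_tsum, Complex.ofReal_re]
  refine (tsum_subtype_eq_of_support_subset (s := {p : ℕ | p.Prime}) fun n hn => ?_).symm
  by_contra h
  exact hn (by simp [primeLog, show ¬ n.Prime from h])

theorem exp_tsum_neg_log_eq_riemannZeta {δ : ℝ} (hδ : 0 < δ) :
    ((Real.exp (∑' p : Nat.Primes, -Real.log (1 - (p : ℝ) ^ (-(1 + δ)))) : ℝ) : ℂ) =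
      riemannZeta (1 + δ) := by
  rw [← riemannZeta_eulerProduct_exp_log (by simpa using hδ), Complex.ofReal_exp,
    Complex.ofReal_tsum]
  congr 2
  ext p
  have h2 := prime_rpow_le_half p.2 hδ.le
  rw [Complex.ofReal_neg, Complex.ofReal_log (by linarith), Complex.ofReal_sub,
    Complex.ofReal_cpow (Nat.cast_nonneg _)]
  push_cast
  rfl

/-- Since $\delta\zeta(1+\delta)\to1$, $\log\zeta(1+\delta)+\log\delta\to0$. The series differs from
$\log\zeta(1+\delta)$ by terms tending to $0$ and dominated by $2/p^2$. -/
theorem tendsto_LSeries_primeLog_add_log_zero :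
    Tendsto (fun δ : ℝ => (LSeries (fun n => (primeLog n : ℂ)) δ).re + Real.log δ) (𝓝[>] 0)
      (𝓝 0) := by
  have h1 : Tendsto (fun δ : ℝ => (∑' p : Nat.Primes, -Real.log (1 - (p : ℝ) ^ (-(1 + δ)))) +
      Real.log δ) (𝓝[>] 0) (𝓝 0) := by
    have h2 : Tendsto (fun δ : ℝ => (1 + δ : ℂ)) (𝓝[>] 0) (𝓝[≠] 1) := by
      refine tendsto_nhdsWithin_iff.2 ⟨?_, ?_⟩
      · have : Continuous fun δ : ℝ => (1 + δ : ℂ) := by fun_prop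
        simpa using (this.tendsto 0).mono_left nhdsWithin_le_nhds
      · filter_upwards [self_mem_nhdsWithin] with δ hδ
        have : δ ≠ 0 := ne_of_gt hδ
        simpa using this
    have h3 := (Complex.continuous_re.tendsto _).comp (riemannZeta_residue_one.comp h2)
    have h4 := ((Real.continuousAt_log one_ne_zero).tendsto).comp h3
    rw [Real.log_one] at h4
    refine h4.congr' ?_
    filter_upwards [self_mem_nhdsWithin] with δ hδ
    rw [Function.comp_apply, Function.comp_apply, Function.comp_apply, ← exp_tsum_neg_log_eq_riemannZeta hδ, add_sub_cancel_left, ← Complex.ofReal_mul,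
      Complex.ofReal_re, Real.log_mul (ne_of_gt hδ) (Real.exp_pos _).ne', Real.log_exp, add_comm]
  have h5 : Tendsto (fun δ : ℝ => ∑' p : Nat.Primes, (primeLog p * (p : ℝ) ^ (-δ) -
      -Real.log (1 - (p : ℝ) ^ (-(1 + δ))))) (𝓝[>] 0) (𝓝 (∑' _ : Nat.Primes, (0 : ℝ))) := by
    refine tendsto_tsum_of_dominated_convergence (summable_primes_inv_sq.mul_left 2)
      (fun p => ?_) ?_
    · have hp0 : (p : ℝ) ≠ 0 := by exact_mod_cast p.2.ne_zero
      have hp := inv_prime_le_half p.2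
      have hc : ContinuousAt (fun δ : ℝ => primeLog p * (p : ℝ) ^ (-δ) -
          -Real.log (1 - (p : ℝ) ^ (-(1 + δ)))) 0 := by
        have h6 : ContinuousAt (fun δ : ℝ => (p : ℝ) ^ (-δ)) 0 :=
          (Real.continuousAt_const_rpow hp0).comp (f := fun δ : ℝ => -δ) (by fun_prop)
        have h7 : ContinuousAt (fun δ : ℝ => (p : ℝ) ^ (-(1 + δ))) 0 :=
          (Real.continuousAt_const_rpow hp0).comp (f := fun δ : ℝ => -(1 + δ)) (by fun_prop)
        refine (continuousAt_const.mul h6).sub (ContinuousAt.neg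
          ((continuousAt_const.sub h7).log ?_))
        have h8 : (1 : ℝ) - (p : ℝ) ^ (-(1 + (0 : ℝ))) ≠ 0 := by
          rw [add_zero, Real.rpow_neg_one]
          linarith
        exact h8
      have := hc.tendsto.mono_left (nhdsWithin_le_nhds (s := Set.Ioi 0))
      simpa [primeLog, p.2, Real.rpow_neg_one] using this
    · filter_upwards [self_mem_nhdsWithin] with δ hδ p
      have hδ0 : 0 ≤ δ := le_of_lt hδ
      have hp1 : (1 : ℝ) ≤ p := by exact_mod_cast p.2.one_le
      have b1 := primeLog_mul_rpow_bounds p hδ0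
      have h2 := prime_rpow_le_half p.2 hδ0
      have h3 : (0 : ℝ) ≤ (p : ℝ) ^ (-(1 + δ)) := Real.rpow_nonneg (Nat.cast_nonneg _) _
      have b2 := le_neg_log_one_sub h2
      have b3 := neg_log_one_sub_le h3 h2
      have b4 : ((p : ℝ) ^ (-(1 + δ))) ^ 2 ≤ (p : ℝ)⁻¹ ^ 2 := by
        refine pow_le_pow_left₀ h3 ?_ 2
        rw [rpow_neg_one_add_eq (by linarith)]
        exact mul_le_of_le_one_right (by positivity) (rpow_neg_mem_Icc hp1 hδ0).2
      rw [Real.norm_eq_abs, abs_le]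
      constructor <;> linarith [b1.1, b1.2]
  rw [tsum_zero] at h5
  have h6 := h5.add h1
  rw [add_zero] at h6
  refine h6.congr' ?_
  filter_upwards [self_mem_nhdsWithin] with δ hδ
  rw [(summable_primeLog_mul_rpow hδ).tsum_sub (summable_neg_log_one_sub_prime_rpow hδ),
    LSeries_primeLog_re]
  ring

theorem tendsto_sum_primeLog_sub_log_log : Tendsto (fun t : ℝ =>
    ∑ k ∈ Finset.Icc 0 ⌊t⌋₊, primeLog k - Real.log (Real.log t)) atTop
    (𝓝 Real.eulerMascheroniConstant) := by
  obtain ⟨C, hC⟩ := exists_tendsto_sum_primeLog_sub_log_log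
  have := tendsto_nhds_unique (tendsto_LSeries_primeLog_add_log hC)
    tendsto_LSeries_primeLog_add_log_zero
  rwa [← sub_eq_zero.1 this]

/-- Mertens' third theorem. -/
theorem tendsto_prod_primes_mul_log : Tendsto (fun n : ℕ =>
    (∏ p ∈ (Finset.Icc 1 n).filter Nat.Prime, (1 - 1 / (p : ℝ))) * Real.log n) atTop
    (𝓝 (Real.exp (-Real.eulerMascheroniConstant))) := by
  have h := (Real.continuous_exp.tendsto _).comp
    (tendsto_sum_primeLog_sub_log_log.comp tendsto_natCast_atTop_atTop).neg
  refine h.congr' ?_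
  filter_upwards [eventually_ge_atTop 2] with n hn
  have hl : 0 < Real.log n := Real.log_pos (by exact_mod_cast hn)
  simp only [Function.comp_apply, Nat.floor_natCast]
  rw [neg_sub, sub_eq_neg_add, Real.exp_add, Real.exp_log hl,
    ← Finset.add_sum_Ioc_eq_sum_Icc (Nat.zero_le _), show primeLog 0 = 0 by
      simp [primeLog, Nat.not_prime_zero], zero_add, Finset.prod_filter,
    ← Finset.sum_neg_distrib (f := fun k => primeLog k), Real.exp_sum]
  congr 1
  refine Finset.prod_congr rfl fun p _ => ?_
  rw [primeLog]
  split_ifs with hp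
  · have := inv_prime_le_half hp
    rw [neg_neg, Real.exp_log (by linarith), one_div]
  · simp

end MertensConstant

/-! ### Factorials -/

theorem primeFactors_factorial (n : ℕ) :
    n.factorial.primeFactors = (Finset.Icc 1 n).filter Nat.Prime := by
  ext p
  simp only [Nat.mem_primeFactors, Finset.mem_filter, Finset.mem_Icc]
  constructor
  · rintro ⟨hp, hd, -⟩
    exact ⟨⟨hp.one_le, hp.dvd_factorial.1 hd⟩, hp⟩
  · rintro ⟨⟨-, h⟩, hp⟩
    exact ⟨hp, hp.dvd_factorial.2 h, n.factorial_ne_zero⟩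

theorem kernelFn_factorial (n : ℕ) :
    kernelFn n.factorial = ∏ p ∈ (Finset.Icc 1 n).filter Nat.Prime, p := by
  rw [kernelFn, primeFactors_factorial]

theorem totient_factorial (n : ℕ) : (Nat.totient n.factorial : ℝ) =
    (n.factorial : ℝ) * ∏ p ∈ (Finset.Icc 1 n).filter Nat.Prime, (1 - 1 / (p : ℝ)) := by
  have h := congrArg (Rat.cast : ℚ → ℝ) (Nat.totient_eq_mul_prod_factors n.factorial)
  rw [primeFactors_factorial] at h
  push_cast at h
  simpa using h

theorem log_kernelFn_factorial (n : ℕ) :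
    Real.log (kernelFn n.factorial) = Chebyshev.theta n := by
  rw [kernelFn_factorial, Nat.cast_prod, Real.log_prod fun p hp => by
    exact_mod_cast (Finset.mem_filter.1 hp).2.ne_zero, Chebyshev.theta, Nat.floor_natCast]
  rfl

theorem kernelFn_pos (n : ℕ) : 0 < kernelFn n :=
  Finset.prod_pos fun _ hp => Nat.pos_of_mem_primeFactors hp

theorem mainTheorem10 :
    (∀ n : ℕ, kernelFn n.factorial = ∏ p ∈ (Finset.Icc 1 n).filter Nat.Prime, p) ∧
    (∀ n : ℕ, (Nat.totient n.factorial : ℝ) =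
      (n.factorial : ℝ) * ∏ p ∈ (Finset.Icc 1 n).filter Nat.Prime, (1 - 1 / (p : ℝ))) ∧
    (∃ ε : ℕ → ℝ, Filter.Tendsto ε Filter.atTop (nhds 0) ∧
      ∀ n : ℕ, (kernelFn n.factorial : ℝ) = Real.exp ((1 + ε n) * (n : ℝ))) ∧
    Asymptotics.IsEquivalent Filter.atTop
      (fun n : ℕ => (Nat.totient n.factorial : ℝ))
      (fun n : ℕ => (n.factorial : ℝ) *
        (Real.exp (-Real.eulerMascheroniConstant) / Real.log (n : ℝ))) := by
  refine ⟨kernelFn_factorial, totient_factorial,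
    ⟨fun n => Chebyshev.theta n / n - 1, ?_, fun n => ?_⟩, ?_⟩
  · simpa using (tendsto_theta_div.comp tendsto_natCast_atTop_atTop).sub_const 1
  · have hpos : (0 : ℝ) < kernelFn n.factorial := by exact_mod_cast kernelFn_pos _
    rw [add_sub_cancel]
    -- At $n=0$ the quotient $\theta(n)/n$ is a junk value, but the exponent is multiplied by $0$
    -- and both sides are $1$.
    rcases eq_or_ne n 0 with rfl | hn
    · simp [kernelFn]
    · rw [div_mul_cancel₀ _ (by exact_mod_cast hn), ← log_kernelFn_factorial, Real.exp_log hpos]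
  · have hlog : ∀ᶠ n : ℕ in atTop, 0 < Real.log n := by
      filter_upwards [eventually_ge_atTop 2] with n hn
      exact Real.log_pos (by exact_mod_cast hn)
    rw [Asymptotics.isEquivalent_iff_tendsto_one]
    · have h := tendsto_prod_primes_mul_log.div_const
        (Real.exp (-Real.eulerMascheroniConstant))
      rw [div_self (Real.exp_pos _).ne'] at h
      refine h.congr' ?_
      filter_upwards [hlog] with n hn
      have := (Real.exp_pos (-Real.eulerMascheroniConstant)).ne'
      rw [Pi.div_apply, totient_factorial]
      field_simp
    · filter_upwards [hlog] with n hn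
      positivity
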